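/- Let $\mathcal V$ be a finite vocabulary with $|\mathcal V|\ge 2$, let $\|\cdot\|$ be any norm on $\mathbb R^d$, and let $\varepsilon>0$, $r>0$, $q\ge 1$. A transformer $\tau$ consists of token embeddings $\mathbf E t\in\mathbb R^d$ ($t\in\mathcal V$), an unembedding matrix $\mathbf F\in\mathbb R^{|\mathcal V|\times d}$ and a stack of layers $\mathrm L$ sending $d\times m$ matrices to $d\times m$ matrices for every $m\ge1$ (nothing else is required of $\mathrm L$). A prompt is a matrix $\mathbf X\in\mathbb R^{d\times m}$, of any length $m\ge 1$, all of whose columns have norm less than $r$. Under greedy decoding $\tau$ generates $\mathbf t=(t_1,\dots,t_n)$ from $\mathbf X$ if, for every $j\le n$, $t_j$ is the index at which the last column of $\mathbf F\,\mathrm L([\mathbf X,\mathbf E t_1,\dots,\mathbf E t_{j-1}])$ is maximal, ties being broken by a fixed but arbitrary rule. Write $\mathrm M(\mathbf X)=\frac1m\sum_{i=1}^m\delta_{\mathbf X_{:,i}}$ and let $W_q(\mu,\nu)=\big(\inf_\pi\int\|x-y\|^q\,d\pi(x,y)\big)^{1/q}$, the infimum being over all couplings $\pi$ of $\mu$ and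 $\nu$; prompts are compared through $W_q(\mathrm M(\mathbf X),\mathrm M(\mathbf Y))$. Put $$K=\Big(e+\frac{e(2r)^q}{\varepsilon^q}\Big)^{(1+4r/\varepsilon)^d}.$$ (a) Call $\mathbf t$ accessible at precision $\varepsilon$ if there is a prompt $\mathbf X$, of some length, such that $\mathbf t$ is generated from every prompt $\mathbf Y$, of any length, with $W_q(\mathrm M(\mathbf X),\mathrm M(\mathbf Y))<\varepsilon$. If $$n>\Big(1+\frac{4r}{\varepsilon}\Big)^d\,\frac{\ln\big(e+e(2r)^q/\varepsilon^q\big)}{\ln|\mathcal V|},$$ then some sequence in $\mathcal V^n$ is not accessible at precision $\varepsilon$. Moreover, for every $n$ the proportion of the sequences in $\mathcal V^n$ that are accessible at precision $\varepsilon$ is at most $K/|\mathcal V|^n$; in particular it is $O(1/|\mathcal V|^n)$ as $n\to\infty$. (b) Suppose that $\tau$ has finite Wasserstein precision $\varepsilon$, that is, there is a finite $\varepsilon$-net $\mathcal G_\varepsilon$ of the set of all prompts under $W_q$, of the smallest possible cardinality, such that each prompt $\mathbf X$ has the same greedy outputs as some element of $\mathcal G_\varepsilon$ that is nearest to $\mathbf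 X$ under $W_q$. Then the conclusions of (a) hold with "accessible" meaning "generated from at least one prompt, of whatever length". -/

import Mathlib

open MeasureTheory Filter
open scoped ENNReal

noncomputable section

/-- A transformer with vocabulary `V` acting on soft prompts, i.e. on finite sequences of vectors of
the embedding space `𝔼` (`ℝ^d` with some norm).  A sequence `[x₁, …, xₘ]` stands for the
`d × m` matrix with these columns.  The stack of layers is an arbitrary length-preserving map, so
attention of any kind, masks, positional encodings and rounding are all allowed. -/
structure Transformer (V 𝔼 : Type*) [AddCommGroup 𝔼] [Module ℝ 𝔼] where
  /-- the embedding matrix, column by column -/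
  embed : V → 𝔼
  /-- the layers `L` -/
  layers : List 𝔼 → List 𝔼
  /-- the layers send an input with `m` columns to an output with `m` columns -/
  length_layers : ∀ X, (layers X).length = X.length
  /-- the unembedding matrix `F` -/
  unembed : 𝔼 →ₗ[ℝ] (V → ℝ)

/-- A greedy decoding rule: it picks a coordinate at which the logits are maximal, ties being broken
in a fixed but arbitrary way. -/
structure GreedyRule (V : Type*) where
  pick : (V → ℝ) → V
  le_pick : ∀ (z : V → ℝ) (v : V), z v ≤ z (pick z)

/-- A soft prompt in the ball of radius `r`: a nonempty sequence of vectors of norm less than `r`. -/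
def IsPrompt {𝔼 : Type*} [NormedAddCommGroup 𝔼] (r : ℝ) (X : List 𝔼) : Prop :=
  X ≠ [] ∧ ∀ x ∈ X, ‖x‖ < r

/-- The empirical measure `M(X) = (1/m) ∑ᵢ δ_{xᵢ}` of a sequence `X` of length `m`. -/
def empirical {𝔼 : Type*} [MeasurableSpace 𝔼] (X : List 𝔼) : Measure 𝔼 :=
  (X.length : ℝ≥0∞)⁻¹ • (X.map fun x => Measure.dirac x).sum

/-- The Wasserstein distance `W_q(μ, ν) = (inf_π ∫ ‖x - y‖^q dπ(x, y))^{1/q}`, the infimum being over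
all couplings `π` of `μ` and `ν`. -/
def wasserstein {𝔼 : Type*} [NormedAddCommGroup 𝔼] [MeasurableSpace 𝔼] (q : ℝ)
    (μ ν : Measure 𝔼) : ℝ≥0∞ :=
  (⨅ (π : Measure (𝔼 × 𝔼)) (_ : π.map Prod.fst = μ ∧ π.map Prod.snd = ν),
    ∫⁻ z, ‖z.1 - z.2‖ₑ ^ q ∂π) ^ (1 / q)

/-- `W_q(M(X), M(Y))`. -/
def promptDist {𝔼 : Type*} [NormedAddCommGroup 𝔼] [MeasurableSpace 𝔼] (q : ℝ)
    (X Y : List 𝔼) : ℝ≥0∞ :=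
  wasserstein q (empirical X) (empirical Y)

namespace Transformer

variable {V 𝔼 : Type*} [NormedAddCommGroup 𝔼] [NormedSpace ℝ 𝔼]

/-- The logits `F L(X)_{:,-1}` of the next token after the nonempty context `X`. -/
def logits (τ : Transformer V 𝔼) (X : List 𝔼) : V → ℝ :=
  τ.unembed ((τ.layers X).getLastD 0)

/-- Under greedy decoding `τ` continues the prompt `X` with the tokens `t₁, …, tₙ`: for every `j`
the token picked after the context `[X, E t₁, …, E t_{j-1}]` is `t_j`. -/
def Generates (τ : Transformer V 𝔼) (g : GreedyRule V) (X : List 𝔼) {n : ℕ} (t : Fin n → V) :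
    Prop :=
  ∀ j : Fin n, g.pick (τ.logits (X ++ ((List.ofFn t).take j).map τ.embed)) = t j

/-- The region `𝓔^m_t` of the soft prompts of length `m` in the ball of radius `r` that lead to the
token sequence `t`. -/
def region (τ : Transformer V 𝔼) (g : GreedyRule V) (r : ℝ) (m : ℕ) {n : ℕ} (t : Fin n → V) :
    Set (List 𝔼) :=
  {X | X.length = m ∧ IsPrompt r X ∧ τ.Generates g X t}

/-- `t` is the greedy output of `τ` on some prompt, of whatever length. -/
def Accessible (τ : Transformer V 𝔼) (g : GreedyRule V) (r : ℝ) {n : ℕ} (t : Fin n → V) : Prop :=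
  ∃ m : ℕ, (τ.region g r m t).Nonempty

variable [MeasurableSpace 𝔼]

/-- `t` is accessible at Wasserstein resolution `ε`: there is a prompt, of whatever length, such
that the whole open `W_q`-ball of radius `ε` around it (in the space of prompts of all lengths)
lies in the regions of `t`. -/
def BallAccessible (τ : Transformer V 𝔼) (g : GreedyRule V) (q ε r : ℝ) {n : ℕ} (t : Fin n → V) :
    Prop :=
  ∃ X : List 𝔼, IsPrompt r X ∧
    ∀ Y : List 𝔼, IsPrompt r Y → promptDist q X Y < ENNReal.ofReal ε →
      Y ∈ τ.region g r Y.length t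

end Transformer

/-- `𝒢` is a finite `ε`-net, under `W_q`, of the prompts in the ball of radius `r`. -/
def IsPromptNet {𝔼 : Type*} [NormedAddCommGroup 𝔼] [MeasurableSpace 𝔼] (q ε r : ℝ)
    (𝒢 : Finset (List 𝔼)) : Prop :=
  (∀ Z ∈ 𝒢, IsPrompt r Z) ∧
    ∀ X : List 𝔼, IsPrompt r X → ∃ Z ∈ 𝒢, promptDist q X Z ≤ ENNReal.ofReal ε

/-- `τ` has finite Wasserstein precision `ε`: for some finite `ε`-net of reference prompts, with no
more elements than needed for an `ε`-net, `τ` does not distinguish a prompt from a reference prompt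
nearest to it, i.e. the two have the same greedy outputs. -/
def Transformer.HasWassersteinPrecision {V 𝔼 : Type*} [NormedAddCommGroup 𝔼] [NormedSpace ℝ 𝔼]
    [MeasurableSpace 𝔼] (τ : Transformer V 𝔼) (g : GreedyRule V) (q ε r : ℝ) : Prop :=
  ∃ 𝒢 : Finset (List 𝔼), IsPromptNet q ε r 𝒢 ∧
    (∀ 𝒢' : Finset (List 𝔼), IsPromptNet q ε r 𝒢' → 𝒢.card ≤ 𝒢'.card) ∧
    ∀ X : List 𝔼, IsPrompt r X →
      ∃ Z ∈ 𝒢, (∀ Z' ∈ 𝒢, promptDist q X Z ≤ promptDist q X Z') ∧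
        ∀ (n : ℕ) (t : Fin n → V), τ.Generates g X t ↔ τ.Generates g Z t

/-- The proportion of the token sequences of length `n` that satisfy `A`. -/
def proportion {V : Type*} [Fintype V] {n : ℕ} (A : (Fin n → V) → Prop) : ℝ :=
  ({t | A t} : Set (Fin n → V)).ncard / (Fintype.card V : ℝ) ^ n

end

/-!
A prompt generates at most one token sequence of each length, so the number of accessible sequences
is at most the size of an `ε`-net of the prompts, and it suffices to bound this size independently
of the lengths of the prompts. By volume comparison the ball of radius `r` has an `ε / 2`-net with
`N ≤ (1 + 4 * r / ε) ^ d` points. Move every column of a prompt to a nearby net point, then round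
the resulting weights to multiples of `1 / k`, where `k` is about `N * (2 * r / ε) ^ q`. Rounding
displaces mass less than `N / (2 * k)` over distance at most `2 * r`, and the other mass moves by at
most `ε / 2`, so the `W_q`-cost is below `ε ^ q / 2 + ε ^ q / 2`. Hence the multisets of `k` net
points form an `ε`-net, and there are at most `(e * (1 + (2 * r / ε) ^ q)) ^ N` of them.
-/

open scoped NNReal

section CoveringBalls

variable {E : Type*} [NormedAddCommGroup E] [NormedSpace ℝ E] [FiniteDimensional ℝ E]
  {x : E} {r : ℝ} {δ : ℝ≥0}

theorem card_le_of_isSeparated_of_subset_ball (hr : 0 ≤ r) (hδ : 0 < δ) {s : Finset E}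
    (hsep : Metric.IsSeparated δ (s : Set E)) (hs : (s : Set E) ⊆ Metric.ball x r) :
    (s.card : ℝ) ≤ (1 + 2 * r / δ) ^ Module.finrank ℝ E := by
  borelize E
  let μ : Measure E := Measure.addHaar
  have hδ' : (0 : ℝ) < δ := hδ
  have hdisj : (s : Set E).Pairwise (Function.onFun Disjoint fun c => Metric.ball c (δ / 2)) :=
    fun c hc c' hc' hne => Metric.ball_disjoint_ball <| by
      have hlt : (δ : ℝ≥0∞) < nndist c c' := edist_nndist c c' ▸ hsep hc hc' hne
      rw [add_halves]
      exact_mod_cast hlt.le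
  have hsub : (⋃ c ∈ s, Metric.ball c (δ / 2)) ⊆ Metric.ball x (r + δ / 2) :=
    Set.iUnion₂_subset fun c hc => Metric.ball_subset_ball' <| by
      linarith [Metric.mem_ball.1 (hs hc)]
  have hvol : s.card * ENNReal.ofReal ((δ / 2) ^ Module.finrank ℝ E) * μ (Metric.ball 0 1) ≤
      ENNReal.ofReal ((r + δ / 2) ^ Module.finrank ℝ E) * μ (Metric.ball 0 1) :=
    calc
      _ = μ (⋃ c ∈ s, Metric.ball c (δ / 2)) := by
        rw [measure_biUnion_finset hdisj fun _ _ => measurableSet_ball]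
        simp only [μ.addHaar_ball_of_pos _ (half_pos hδ'), Finset.sum_const, nsmul_eq_mul,
          mul_assoc]
      _ ≤ μ (Metric.ball x (r + δ / 2)) := measure_mono hsub
      _ = _ := by rw [μ.addHaar_ball_of_pos _ (by positivity)]
  have hcard : s.card * (δ / 2 : ℝ) ^ Module.finrank ℝ E ≤ (r + δ / 2) ^ Module.finrank ℝ E := by
    have hle := ENNReal.toReal_le_of_le_ofReal (by positivity) <| (ENNReal.mul_le_mul_iff_left
      (Metric.measure_ball_pos _ _ zero_lt_one).ne' measure_ball_lt_top.ne).1 hvol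
    rwa [ENNReal.toReal_mul, ENNReal.toReal_natCast, ENNReal.toReal_ofReal (by positivity)] at hle
  have hratio : 1 + 2 * r / δ = (r + δ / 2) / (δ / 2) := by field_simp; ring
  rwa [hratio, div_pow, le_div_iff₀ (by positivity)]

theorem packingNumber_ball_le (hr : 0 ≤ r) (hδ : 0 < δ) :
    Metric.packingNumber δ (Metric.ball x r) ≤
      (⌊(1 + 2 * r / δ) ^ Module.finrank ℝ E⌋₊ : ℕ∞) := by
  refine iSup_le fun C => iSup₂_le fun hC hsep => ?_
  by_contra! hlt
  obtain ⟨t, htC, ht⟩ := Set.exists_subset_encard_eq (Order.add_one_le_of_lt hlt)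
  have htfin : t.Finite := Set.finite_of_encard_eq_coe (k := _ + 1) (by exact_mod_cast ht)
  lift t to Finset E using htfin
  have hcard := Nat.le_floor <| card_le_of_isSeparated_of_subset_ball hr hδ (hsep.subset htC)
    (htC.trans hC)
  rw [Set.encard_coe_eq_coe_finsetCard] at ht
  norm_cast at ht
  omega

theorem exists_finset_isCover_ball (hr : 0 ≤ r) (hδ : 0 < δ) :
    ∃ s : Finset E, (s : Set E) ⊆ Metric.ball x r ∧ Metric.IsCover δ (Metric.ball x r) s ∧
      (s.card : ℝ) ≤ (1 + 2 * r / δ) ^ Module.finrank ℝ E := by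
  have hpack := packingNumber_ball_le (x := x) hr hδ
  have hne : Metric.packingNumber δ (Metric.ball x r) ≠ ⊤ := ne_top_of_le_ne_top (by simp) hpack
  rw [← Metric.encard_maximalSeparatedSet hne] at hpack
  obtain ⟨s, hs⟩ := (Set.finite_of_encard_le_coe hpack).exists_finset_coe
  rw [← hs, Set.encard_coe_eq_coe_finsetCard, Nat.cast_le, Nat.le_floor_iff (by positivity)]
    at hpack
  exact ⟨s, hs ▸ Metric.maximalSeparatedSet_subset, hs ▸ Metric.isCover_maximalSeparatedSet hne,
    hpack⟩

end CoveringBalls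

section Rounding

variable {ι : Type*} [Fintype ι]

theorem exists_nat_sum_eq_sum_tsub_lt [Nonempty ι] {k : ℕ} (y : ι → ℝ≥0) (hy : ∑ i, y i = k) :
    ∃ b : ι → ℕ, ∑ i, b i = k ∧ ∑ i, (y i - b i) < Fintype.card ι / 2 := by
  classical
  let f : ι → ℝ≥0 := fun i => y i - ⌊y i⌋₊
  have hf_lt (i : ι) : f i < 1 :=
    (tsub_lt_iff_left (Nat.floor_le zero_le)).2 (Nat.lt_floor_add_one _)
  have hf_add (i : ι) : ⌊y i⌋₊ + f i = y i := add_tsub_cancel_of_le (Nat.floor_le zero_le)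
  have hsum : ((∑ i, ⌊y i⌋₊ : ℕ) : ℝ≥0) + ∑ i, f i = k := by
    simp only [Nat.cast_sum, ← Finset.sum_add_distrib, hf_add, hy]
  obtain ⟨j, hj⟩ : ∃ j, k = ∑ i, ⌊y i⌋₊ + j :=
    Nat.exists_eq_add_of_le <| Nat.cast_le.1 <| hsum ▸ le_self_add
  have hfj : ∑ i, f i = j := by rw [hj, Nat.cast_add] at hsum; exact add_left_cancel hsum
  have hjN : j < Fintype.card ι := by
    have : ∑ i, f i < ∑ _i : ι, 1 :=
      Finset.sum_lt_sum_of_nonempty Finset.univ_nonempty fun i _ => hf_lt i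
    rw [hfj] at this
    simpa using this
  obtain ⟨S, -, hS⟩ := Finset.exists_subset_card_eq (s := (Finset.univ : Finset ι)) hjN.le
  have hScard : S.card + Sᶜ.card = Fintype.card ι := Finset.card_add_card_compl S
  refine ⟨fun i => ⌊y i⌋₊ + if i ∈ S then 1 else 0, ?_, ?_⟩
  · simp [Finset.sum_add_distrib, hS, hj]
  have hexcess : ∑ i, (y i - ((⌊y i⌋₊ + if i ∈ S then 1 else 0 : ℕ) : ℝ≥0)) = ∑ i ∈ Sᶜ, f i := by
    have hS_zero : ∑ i ∈ S, (y i - ((⌊y i⌋₊ + if i ∈ S then 1 else 0 : ℕ) : ℝ≥0)) = 0 :=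
      Finset.sum_eq_zero fun i hi => by
        simpa [hi] using tsub_eq_zero_of_le (Nat.lt_floor_add_one (y i)).le
    rw [← Finset.sum_add_sum_compl S, hS_zero, zero_add]
    refine Finset.sum_congr rfl fun i hi => ?_
    simp [f, Finset.mem_compl.1 hi]
  -- The excess is at most `#S` and less than `#Sᶜ`, and these two numbers add up to `card ι`.
  have hle : ∑ i ∈ Sᶜ, f i ≤ S.card := by
    rw [hS, ← hfj]
    exact Finset.sum_le_sum_of_subset (Finset.subset_univ _)
  have hlt : ∑ i ∈ Sᶜ, f i < Sᶜ.card := by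
    have hne : Sᶜ.Nonempty := Finset.card_pos.1 (by omega)
    simpa using Finset.sum_lt_sum_of_nonempty hne fun i _ => hf_lt i
  rw [hexcess, lt_div_iff₀ two_pos, mul_two, ← hScard, Nat.cast_add]
  exact add_lt_add_of_le_of_lt hle hlt

end Rounding

section Transport

variable {L ι : Type*} [Fintype L] [Fintype ι]

/-- A transport plan (coupling) between the weight vectors `p` and `b` of two finitely supported
measures: `w l i` is the mass moved from `l` to `i`. -/
structure IsTransportPlan (w : L → ι → ℝ≥0) (p : L → ℝ≥0) (b : ι → ℝ≥0) : Prop where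
  sum_row : ∀ l, ∑ i, w l i = p l
  sum_col : ∀ i, ∑ l, w l i = b i

/-- Keep the mass `min (a i) (b i)` in place and distribute the excess `a - b` proportionally to
the deficit `b - a`. -/
theorem exists_isTransportPlan_sum_compl_eq_tsub [DecidableEq ι] (a b : ι → ℝ≥0)
    (hab : ∑ i, a i = ∑ i, b i) :
    ∃ u, IsTransportPlan u a b ∧ ∀ i, ∑ j ∈ {i}ᶜ, u i j = a i - b i := by
  let T : ℝ≥0 := ∑ i, (a i - b i)
  have hT : ∑ i, (b i - a i) = T := by
    apply add_right_cancel (b := ∑ i, min (a i) (b i))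
    calc
      _ = ∑ i, b i := by simp only [← Finset.sum_add_distrib, min_comm (a _), tsub_add_min]
      _ = ∑ i, a i := hab.symm
      _ = _ := by simp only [T, ← Finset.sum_add_distrib, tsub_add_min]
  have hexcess (i : ι) : (a i - b i) * T / T = a i - b i :=
    mul_div_cancel_of_imp fun h => Finset.sum_eq_zero_iff.1 h i (Finset.mem_univ i)
  have hdeficit (i : ι) : T * (b i - a i) / T = b i - a i :=
    mul_div_cancel_left_of_imp fun h =>
      Finset.sum_eq_zero_iff.1 (hT.trans h) i (Finset.mem_univ i)
  let u : ι → ι → ℝ≥0 := fun i j =>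
    (if i = j then min (a i) (b i) else 0) + (a i - b i) * (b j - a j) / T
  have hrow (i : ι) : ∑ j, u i j = a i := by
    simp only [u, Finset.sum_add_distrib, Finset.sum_ite_eq, Finset.mem_univ, if_true,
      ← Finset.sum_div, ← Finset.mul_sum, hT, hexcess]
    rw [add_comm, tsub_add_min]
  have hcol (j : ι) : ∑ i, u i j = b j := by
    simp only [u, Finset.sum_add_distrib, Finset.sum_ite_eq', Finset.mem_univ, if_true,
      ← Finset.sum_div, ← Finset.sum_mul]
    rw [hdeficit, add_comm, min_comm, tsub_add_min]
  have hdiag (i : ι) : u i i = min (a i) (b i) := by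
    have : (a i - b i) * (b i - a i) = 0 := by
      rcases le_total (a i) (b i) with h | h <;> simp [tsub_eq_zero_of_le h]
    simp [u, this]
  refine ⟨u, ⟨hrow, hcol⟩, fun i => ?_⟩
  rw [← tsub_min, ← hdiag, ← hrow i, Fintype.sum_eq_add_sum_compl i, add_tsub_cancel_left]

/-- Split the mass arriving at `i` among the points of the fibre of `i` proportionally to their
weights. -/
theorem IsTransportPlan.exists_sum_fiber_eq [DecidableEq ι] {p : L → ℝ≥0} {c : L → ι}
    {b : ι → ℝ≥0} {u : ι → ι → ℝ≥0}
    (hu : IsTransportPlan u (fun i => ∑ l with c l = i, p l) b) :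
    ∃ w, IsTransportPlan w p b ∧ ∀ i j, ∑ l with c l = i, w l j = u i j := by
  let a : ι → ℝ≥0 := fun i => ∑ l with c l = i, p l
  have hfiber (i j : ι) : ∑ l with c l = i, p l * u (c l) j / a (c l) = u i j := by
    have hzero (h : a i = 0) : u i j = 0 :=
      Finset.sum_eq_zero_iff.1 ((hu.sum_row i).trans h) j (Finset.mem_univ j)
    calc
      _ = ∑ l with c l = i, p l * u i j / a i := Finset.sum_congr rfl fun l hl => by
        rw [(Finset.mem_filter.1 hl).2]
      _ = a i * u i j / a i := by rw [← Finset.sum_div, ← Finset.sum_mul]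
      _ = u i j := mul_div_cancel_left_of_imp hzero
  refine ⟨fun l j => p l * u (c l) j / a (c l), ⟨fun l => ?_, fun j => ?_⟩, hfiber⟩
  · have hzero (h : a (c l) = 0) : p l = 0 :=
      Finset.sum_eq_zero_iff.1 h l (by simp)
    rw [← Finset.sum_div, ← Finset.mul_sum, hu.sum_row]
    exact mul_div_cancel_of_imp hzero
  · rw [← Finset.sum_fiberwise Finset.univ c]
    simp only [hfiber, hu.sum_col]

theorem exists_isTransportPlan_sum_compl_eq_sum_fiber_tsub [DecidableEq ι] (p : L → ℝ≥0)
    (b : ι → ℝ≥0) (c : L → ι) (hpb : ∑ l, p l = ∑ i, b i) :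
    ∃ w, IsTransportPlan w p b ∧
      ∑ l, ∑ i ∈ {c l}ᶜ, w l i = ∑ i, ((∑ l with c l = i, p l) - b i) := by
  obtain ⟨u, hu, hoff⟩ := exists_isTransportPlan_sum_compl_eq_tsub
    (fun i => ∑ l with c l = i, p l) b ((Finset.sum_fiberwise Finset.univ c p).trans hpb)
  obtain ⟨w, hw, hfiber⟩ := hu.exists_sum_fiber_eq
  refine ⟨w, hw, ?_⟩
  calc
    _ = ∑ i, ∑ l with c l = i, ∑ j ∈ {c l}ᶜ, w l j := (Finset.sum_fiberwise Finset.univ c _).symm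
    _ = ∑ i, ∑ l with c l = i, ∑ j ∈ {i}ᶜ, w l j := Finset.sum_congr rfl fun i _ =>
      Finset.sum_congr rfl fun l hl => by rw [(Finset.mem_filter.1 hl).2]
    _ = ∑ i, ∑ j ∈ {i}ᶜ, u i j := Finset.sum_congr rfl fun i _ => by
      rw [Finset.sum_comm]
      exact Finset.sum_congr rfl fun j _ => hfiber i j
    _ = _ := Finset.sum_congr rfl fun i _ => hoff i

theorem IsTransportPlan.sum_mul_le [DecidableEq ι] {w : L → ι → ℝ≥0} {p : L → ℝ≥0} {b : ι → ℝ≥0}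
    (hw : IsTransportPlan w p b) (c : L → ι) {D : L → ι → ℝ} {α β : ℝ} (hα : 0 ≤ α)
    (hDα : ∀ l, D l (c l) ≤ α) (hDβ : ∀ l i, D l i ≤ β) :
    ∑ l, ∑ i, w l i * D l i ≤
      (∑ l, p l : ℝ≥0) * α + (∑ l, ∑ i ∈ {c l}ᶜ, w l i : ℝ≥0) * β := by
  push_cast
  simp only [Finset.sum_mul, ← Finset.sum_add_distrib]
  gcongr with l
  rw [Fintype.sum_eq_add_sum_compl (c l)]
  have hle : w l (c l) ≤ p l :=
    hw.sum_row l ▸ Finset.single_le_sum (fun _ _ => zero_le) (Finset.mem_univ _)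
  refine add_le_add ?_ (Finset.sum_le_sum fun i _ => ?_)
  · exact (mul_le_mul_of_nonneg_left (hDα l) (NNReal.coe_nonneg _)).trans
      (mul_le_mul_of_nonneg_right hle hα)
  · exact mul_le_mul_of_nonneg_left (hDβ l i) (NNReal.coe_nonneg _)

variable {𝔼 : Type*} [NormedAddCommGroup 𝔼] [MeasurableSpace 𝔼]

theorem IsTransportPlan.wasserstein_sum_dirac_le [MeasurableSingletonClass 𝔼]
    {w : L → ι → ℝ≥0} {p : L → ℝ≥0} {b : ι → ℝ≥0} (hw : IsTransportPlan w p b) {q : ℝ}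
    (hq : 0 < q) (x : L → 𝔼) (z : ι → 𝔼) :
    wasserstein q (∑ l, (p l : ℝ≥0∞) • Measure.dirac (x l))
      (∑ i, (b i : ℝ≥0∞) • Measure.dirac (z i)) ≤
      ENNReal.ofReal (∑ l, ∑ i, w l i * ‖x l - z i‖ ^ q) ^ (1 / q) := by
  let π : Measure (𝔼 × 𝔼) := ∑ l, ∑ i, (w l i : ℝ≥0∞) • Measure.dirac (x l, z i)
  have hmap {f : 𝔼 × 𝔼 → 𝔼} (hf : Measurable f) :
      π.map f = ∑ l, ∑ i, (w l i : ℝ≥0∞) • Measure.dirac (f (x l, z i)) := by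
    simp only [π, ← Measure.mapₗ_apply_of_measurable hf, map_sum, map_smul]
    simp only [Measure.mapₗ_apply_of_measurable hf, Measure.map_dirac' hf]
  have hfst : π.map Prod.fst = ∑ l, (p l : ℝ≥0∞) • Measure.dirac (x l) := by
    simp only [hmap measurable_fst, ← Finset.sum_smul, ← hw.sum_row, ENNReal.ofNNReal_finsetSum]
  have hsnd : π.map Prod.snd = ∑ i, (b i : ℝ≥0∞) • Measure.dirac (z i) := by
    rw [hmap measurable_snd, Finset.sum_comm]
    simp only [← Finset.sum_smul, ← hw.sum_col, ENNReal.ofNNReal_finsetSum]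
  have hcost : ∫⁻ y, ‖y.1 - y.2‖ₑ ^ q ∂π =
      ENNReal.ofReal (∑ l, ∑ i, w l i * ‖x l - z i‖ ^ q) := by
    have hterm (l : L) (i : ι) : (0 : ℝ) ≤ w l i * ‖x l - z i‖ ^ q := by positivity
    simp only [π, lintegral_finsetSum_measure, lintegral_smul_measure, lintegral_dirac, smul_eq_mul]
    rw [ENNReal.ofReal_sum_of_nonneg fun l _ => Finset.sum_nonneg fun i _ => hterm l i]
    simp only [ENNReal.ofReal_sum_of_nonneg fun i _ => hterm _ i,
      ENNReal.ofReal_mul (NNReal.coe_nonneg _), ENNReal.ofReal_coe_nnreal,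
      ← ENNReal.ofReal_rpow_of_nonneg (norm_nonneg _) hq.le, ofReal_norm]
  exact ENNReal.rpow_le_rpow ((iInf₂_le π ⟨hfst, hsnd⟩).trans_eq hcost) (by positivity)

end Transport

section Empirical

variable {L ι 𝔼 : Type*} [DecidableEq ι]

/-- The empirical frequency of `i` in the multiset `s`; every frequency in the empty multiset
is `0`. -/
noncomputable def empiricalFreq (s : Multiset ι) (i : ι) : ℝ≥0 :=
  s.count i / s.card

theorem sum_empiricalFreq [Fintype ι] {s : Multiset ι} (hs : s ≠ 0) :
    ∑ i, empiricalFreq s i = 1 := by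
  simp only [empiricalFreq, ← Finset.sum_div, ← Nat.cast_sum,
    Multiset.sum_count_eq_card fun i _ => Finset.mem_univ i]
  exact div_self (by simpa using hs)

theorem exists_sum_tsub_empiricalFreq_lt [Fintype ι] (a : ι → ℝ≥0) (ha : ∑ i, a i = 1) {k : ℕ}
    (hk : 0 < k) :
    ∃ s : Multiset ι, s.card = k ∧
      ∑ i, (a i - empiricalFreq s i) < Fintype.card ι / (2 * k) := by
  have : Nonempty ι := by
    by_contra! h
    simp at ha
  have hk' : (0 : ℝ≥0) < k := by exact_mod_cast hk
  obtain ⟨b, hbk, hb⟩ := exists_nat_sum_eq_sum_tsub_lt (fun i => k * a i)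
    (by rw [← Finset.mul_sum, ha, mul_one])
  let s : Multiset ι := ∑ i, Multiset.replicate (b i) i
  have hcard : s.card = k := by simp [s, Multiset.card_sum, hbk]
  have hcount (i : ι) : s.count i = b i := by
    simp [s, Multiset.count_sum', Multiset.count_replicate]
  refine ⟨s, hcard, ?_⟩
  calc
    _ = (∑ i, (k * a i - b i)) / k := by
      rw [Finset.sum_div]
      refine Finset.sum_congr rfl fun i _ => ?_
      rw [empiricalFreq, hcount, hcard, NNReal.sub_div, mul_div_cancel_left₀ _ hk'.ne']
    _ < Fintype.card ι / 2 / k := by gcongr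
    _ = _ := div_div _ _ _

variable [MeasurableSpace 𝔼]

theorem empirical_map [Fintype ι] (z : ι → 𝔼) (s : List ι) :
    empirical (s.map z) = ∑ i, (empiricalFreq (s : Multiset ι) i : ℝ≥0∞) • Measure.dirac (z i) := by
  rcases eq_or_ne s [] with rfl | hs
  · simp [empirical, empiricalFreq]
  have hlen : (s.length : ℝ≥0) ≠ 0 := by simpa using hs
  have hfreq (i : ι) : (empiricalFreq (s : Multiset ι) i : ℝ≥0∞) =
      (s.length : ℝ≥0∞)⁻¹ * s.count i := by
    rw [empiricalFreq, Multiset.coe_count, Multiset.coe_card, ENNReal.coe_div hlen,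
      ENNReal.coe_natCast, ENNReal.coe_natCast, div_eq_mul_inv, mul_comm]
  simp only [hfreq, mul_smul, ← Finset.smul_sum, Nat.cast_smul_eq_nsmul, empirical,
    List.length_map, List.map_map, Finset.sum_list_map_count]
  congr 1
  refine Finset.sum_subset (Finset.subset_univ _) fun i _ hi => ?_
  rw [List.count_eq_zero_of_not_mem (by simpa using hi), zero_smul]

theorem IsTransportPlan.promptDist_map_le [NormedAddCommGroup 𝔼] [MeasurableSingletonClass 𝔼]
    [Fintype L] [DecidableEq L] [Fintype ι] {w : L → ι → ℝ≥0} {s : List L} {t : List ι}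
    (hw : IsTransportPlan w (empiricalFreq (s : Multiset L)) (empiricalFreq (t : Multiset ι)))
    {q : ℝ} (hq : 0 < q) (x : L → 𝔼) (z : ι → 𝔼) :
    promptDist q (s.map x) (t.map z) ≤
      ENNReal.ofReal (∑ l, ∑ i, w l i * ‖x l - z i‖ ^ q) ^ (1 / q) := by
  rw [promptDist, empirical_map, empirical_map]
  exact hw.wasserstein_sum_dirac_le hq x z

end Empirical

theorem multichoose_le_exp_one_mul_pow {N k : ℕ} {A : ℝ} (hA : 0 ≤ A) (hk : k ≤ N * A + 1) :
    (N.multichoose k : ℝ) ≤ (Real.exp 1 * (1 + A)) ^ N := by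
  rcases N with _ | n
  · have hk1 : (k : ℝ) ≤ 1 := by simpa using hk
    norm_cast at hk1
    interval_cases k <;> simp
  set M : ℝ := (n + 1 : ℕ) * (1 + A) with hM
  have hnM : ((n + 1 : ℕ) : ℝ) ≤ M := le_mul_of_one_le_right (by positivity) (by linarith)
  have hkM : ((n + k : ℕ) : ℝ) ≤ M := by
    push_cast [hM] at hk ⊢
    linarith
  calc
    ((n + 1).multichoose k : ℝ) = (n + k).choose n := by
      rw [Nat.multichoose_eq, Nat.choose_symm_of_eq_add (b := n) (by omega)]
      congr 2
      omega
    _ ≤ ((n + k : ℕ) : ℝ) ^ n / n.factorial := Nat.choose_le_pow_div n (n + k)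
    _ = (n + 1 : ℕ) * ((n + k : ℕ) : ℝ) ^ n / (n + 1).factorial := by
      rw [Nat.factorial_succ, Nat.cast_mul, mul_div_mul_left _ _ (by positivity)]
    _ ≤ M * M ^ n / (n + 1).factorial := by gcongr
    _ = (1 + A) ^ (n + 1) * ((n + 1 : ℕ) ^ (n + 1) / (n + 1).factorial) := by
      rw [← pow_succ', hM, mul_pow]
      ring
    _ ≤ (1 + A) ^ (n + 1) * Real.exp (n + 1 : ℕ) := by
      gcongr
      exact Real.pow_div_factorial_le_exp _ (by positivity) _
    _ = (Real.exp 1 * (1 + A)) ^ (n + 1) := by rw [mul_pow, Real.exp_one_pow, mul_comm]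

section PromptNet

variable {𝔼 ι : Type*} [NormedAddCommGroup 𝔼] [MeasurableSpace 𝔼]

theorem exists_sym_promptDist_lt [MeasurableSingletonClass 𝔼] [Fintype ι] {q α β : ℝ}
    (hq : 0 < q) (hβ : 0 < β) {k : ℕ} (hk : 0 < k) {X : List 𝔼} (hX : X ≠ []) (z : ι → 𝔼)
    (hα : ∀ x ∈ X, ∃ i, ‖x - z i‖ ≤ α) (hXβ : ∀ x ∈ X, ∀ i, ‖x - z i‖ ≤ β) :
    ∃ s : Sym ι k, promptDist q X ((s : Multiset ι).toList.map z) <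
      ENNReal.ofReal (α ^ q + Fintype.card ι / (2 * k) * β ^ q) ^ (1 / q) := by
  classical
  obtain ⟨x₀, hx₀⟩ := List.exists_mem_of_ne_nil X hX
  have hα₀ : 0 ≤ α := (hα x₀ hx₀).elim fun i hi => (norm_nonneg _).trans hi
  choose c hc using fun l => hα (X.get l) (List.get_mem X l)
  let p := empiricalFreq (List.finRange X.length : Multiset (Fin X.length))
  have hp : ∑ l, p l = 1 := sum_empiricalFreq <| by simpa using hX
  obtain ⟨s, hsk, hs⟩ := exists_sum_tsub_empiricalFreq_lt (fun i => ∑ l with c l = i, p l)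
    ((Finset.sum_fiberwise Finset.univ c p).trans hp) hk
  have hs₀ : s ≠ 0 := by rwa [← Multiset.card_pos, hsk]
  obtain ⟨w, hw, hmoved⟩ := exists_isTransportPlan_sum_compl_eq_sum_fiber_tsub p (empiricalFreq s) c
    (hp.trans (sum_empiricalFreq hs₀).symm)
  rw [← hmoved] at hs
  have hcost := hw.sum_mul_le c (D := fun l i => ‖X.get l - z i‖ ^ q)
    (Real.rpow_nonneg hα₀ q)
    (fun l => Real.rpow_le_rpow (norm_nonneg _) (hc l) hq.le)
    fun l i => Real.rpow_le_rpow (norm_nonneg _) (hXβ _ (List.get_mem X l) i) hq.le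
  have hcost_lt : ∑ l, ∑ i, w l i * ‖X.get l - z i‖ ^ q <
      α ^ q + Fintype.card ι / (2 * k) * β ^ q := by
    refine hcost.trans_lt ?_
    rw [hp, NNReal.coe_one, one_mul]
    gcongr
    exact_mod_cast hs
  have hdist := IsTransportPlan.promptDist_map_le (s := List.finRange X.length) (t := s.toList)
    (by rwa [Multiset.coe_toList]) hq X.get z
  rw [List.map_get_finRange] at hdist
  refine ⟨⟨s, hsk⟩, hdist.trans_lt <| ENNReal.rpow_lt_rpow ?_ (by positivity)⟩
  exact (ENNReal.ofReal_lt_ofReal_iff_of_nonneg (by positivity)).2 hcost_lt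

/-- A finite `ε`-net, under `W_q`, of the prompts in the ball of radius `r` whose open `ε`-balls
already cover; `IsPromptNet` uses closed balls. -/
structure IsOpenPromptNet (q ε r : ℝ) (𝒢 : Finset (List 𝔼)) : Prop where
  isPrompt : ∀ Z ∈ 𝒢, IsPrompt r Z
  exists_promptDist_lt : ∀ X, IsPrompt r X → ∃ Z ∈ 𝒢, promptDist q X Z < ENNReal.ofReal ε

theorem IsOpenPromptNet.isPromptNet {q ε r : ℝ} {𝒢 : Finset (List 𝔼)}
    (h : IsOpenPromptNet q ε r 𝒢) : IsPromptNet q ε r 𝒢 :=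
  ⟨h.isPrompt, fun X hX => (h.exists_promptDist_lt X hX).imp fun _ => And.imp_right le_of_lt⟩

theorem half_rpow_add_le_rpow {q ε b N k : ℝ} (hq : 1 ≤ q) (hε : 0 < ε) (hk : 0 < k)
    (hNk : N * (b / ε ^ q) ≤ k) : (ε / 2) ^ q + N / (2 * k) * b ≤ ε ^ q := by
  have hhalf : (ε / 2) ^ q ≤ ε ^ q / 2 := by
    rw [Real.div_rpow hε.le zero_le_two]
    have : (2 : ℝ) ≤ 2 ^ q := Real.self_le_rpow_of_one_le one_le_two hq
    gcongr
  have hrest : N / (2 * k) * b ≤ ε ^ q / 2 := by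
    rw [← mul_div_assoc, div_le_iff₀ (by positivity)] at hNk
    rw [div_mul_eq_mul_div, div_le_iff₀ (by positivity)]
    linarith
  linarith

theorem exists_isOpenPromptNet_of_isCover [MeasurableSingletonClass 𝔼] {q ε r : ℝ} (hq : 1 ≤ q)
    (hε : 0 < ε) {S : Finset 𝔼} (hSr : (S : Set 𝔼) ⊆ Metric.ball 0 r)
    (hS : Metric.IsCover (ε / 2).toNNReal (Metric.ball 0 r) (S : Set 𝔼)) {k : ℕ} (hk : 0 < k)
    (hSk : S.card * ((2 * r) ^ q / ε ^ q) ≤ k) :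
    ∃ 𝒢 : Finset (List 𝔼), IsOpenPromptNet q ε r 𝒢 ∧ 𝒢.card ≤ S.card.multichoose k := by
  classical
  let toPrompt (s : Sym S k) : List 𝔼 := (s : Multiset S).toList.map Subtype.val
  refine ⟨Finset.univ.image toPrompt, ⟨fun Z hZ => ?_, fun X hX => ?_⟩, ?_⟩
  · obtain ⟨s, -, rfl⟩ := Finset.mem_image.1 hZ
    refine ⟨fun h => ?_, fun x hx => ?_⟩
    · have hlen := congrArg List.length h
      simp only [toPrompt, List.length_map, Multiset.length_toList, List.length_nil] at hlen
      exact hk.ne' (s.2.symm.trans hlen)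
    · obtain ⟨y, -, rfl⟩ := List.mem_map.1 hx
      exact mem_ball_zero_iff.1 (hSr y.2)
  · have hnear : ∀ x ∈ X, ∃ y : S, ‖x - y‖ ≤ ε / 2 := fun x hx => by
      obtain ⟨y, hy, hxy⟩ := hS (mem_ball_zero_iff.2 (hX.2 x hx))
      refine ⟨⟨y, hy⟩, ?_⟩
      rw [← dist_eq_norm]
      exact (edist_le_ofReal (by positivity)).1 hxy
    have hfar : ∀ x ∈ X, ∀ y : S, ‖x - y‖ ≤ 2 * r := fun x hx y => by
      linarith [norm_sub_le x y, hX.2 x hx, mem_ball_zero_iff.1 (hSr y.2)]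
    have hr : 0 < r := by
      obtain ⟨x, hx⟩ := List.exists_mem_of_ne_nil X hX.1
      exact (norm_nonneg x).trans_lt (hX.2 x hx)
    obtain ⟨s, hs⟩ := exists_sym_promptDist_lt (one_pos.trans_le hq) (by positivity) hk hX.1
      Subtype.val hnear hfar
    refine ⟨toPrompt s, Finset.mem_image_of_mem _ (Finset.mem_univ _), hs.trans_le ?_⟩
    calc
      _ ≤ ENNReal.ofReal (ε ^ q) ^ (1 / q) := by
        gcongr
        exact half_rpow_add_le_rpow hq hε (by exact_mod_cast hk) (by simpa using hSk)
      _ = ENNReal.ofReal ε := by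
        rw [← ENNReal.ofReal_rpow_of_pos hε, one_div, ENNReal.rpow_rpow_inv (by positivity)]
  · exact Finset.card_image_le.trans_eq <| by
      rw [Finset.card_univ, Sym.card_sym_eq_multichoose, Fintype.card_coe]

theorem exists_isOpenPromptNet_card_le [NormedSpace ℝ 𝔼] [FiniteDimensional ℝ 𝔼] [BorelSpace 𝔼]
    {q ε r : ℝ} (hq : 1 ≤ q) (hε : 0 < ε) (hr : 0 < r) :
    ∃ 𝒢 : Finset (List 𝔼), IsOpenPromptNet q ε r 𝒢 ∧
      (𝒢.card : ℝ) ≤ (Real.exp 1 + Real.exp 1 * (2 * r) ^ q / ε ^ q) ^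
        ((1 + 4 * r / ε) ^ Module.finrank ℝ 𝔼) := by
  have hδ : 0 < (ε / 2).toNNReal := Real.toNNReal_pos.2 (half_pos hε)
  obtain ⟨S, hSr, hS, hScard⟩ := exists_finset_isCover_ball (x := (0 : 𝔼)) hr.le hδ
  have hSne : 0 < S.card := Finset.card_pos.2 <|
    (hS (Metric.mem_ball_self hr)).imp fun _ => And.left
  set A : ℝ := (2 * r) ^ q / ε ^ q with hA
  have hA₀ : 0 < A := by positivity
  obtain ⟨𝒢, h𝒢, hcard⟩ := exists_isOpenPromptNet_of_isCover hq hε hSr hS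
    (Nat.ceil_pos.2 (by positivity)) (Nat.le_ceil (S.card * A))
  refine ⟨𝒢, h𝒢, ?_⟩
  have hone : 1 ≤ Real.exp 1 * (1 + A) :=
    one_le_mul_of_one_le_of_one_le (Real.one_le_exp zero_le_one) (by linarith)
  have hbase : Real.exp 1 + Real.exp 1 * (2 * r) ^ q / ε ^ q = Real.exp 1 * (1 + A) := by
    rw [hA]; ring
  have hexp : 1 + 2 * r / (ε / 2).toNNReal = 1 + 4 * r / ε := by
    rw [Real.coe_toNNReal _ (half_pos hε).le]; ring
  calc
    (𝒢.card : ℝ) ≤ S.card.multichoose ⌈S.card * A⌉₊ := by exact_mod_cast hcard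
    _ ≤ (Real.exp 1 * (1 + A)) ^ S.card :=
      multichoose_le_exp_one_mul_pow hA₀.le (Nat.ceil_lt_add_one (by positivity)).le
    _ = (Real.exp 1 * (1 + A)) ^ (S.card : ℝ) := (Real.rpow_natCast _ _).symm
    _ ≤ _ := by
      rw [hbase, ← hexp]
      exact Real.rpow_le_rpow_of_exponent_le hone hScard

end PromptNet

section TokenSequences

variable {V 𝔼 : Type*} {n : ℕ}

section Generates

variable [NormedAddCommGroup 𝔼] [NormedSpace ℝ 𝔼] {τ : Transformer V 𝔼} {g : GreedyRule V}

theorem Transformer.Generates.unique {X : List 𝔼} {t u : Fin n → V} (ht : τ.Generates g X t)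
    (hu : τ.Generates g X u) : t = u := by
  suffices ∀ (j : ℕ) (hj : j < n), t ⟨j, hj⟩ = u ⟨j, hj⟩ from funext fun j => this j j.2
  intro j
  induction j using Nat.strong_induction_on with
  | _ j ih =>
    intro hj
    have hprefix : (List.ofFn t).take j = (List.ofFn u).take j :=
      List.ext_getElem (by simp) fun i hi _ => by
        simp only [List.length_take, List.length_ofFn] at hi
        simpa only [List.getElem_take, List.getElem_ofFn] using ih i (by omega) (by omega)
    rw [← ht ⟨j, hj⟩, ← hu ⟨j, hj⟩, hprefix]

theorem Transformer.ncard_le_of_generates {𝒢 : Finset (List 𝔼)} {A : (Fin n → V) → Prop}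
    (hA : ∀ t, A t → ∃ Z ∈ 𝒢, τ.Generates g Z t) :
    ({t | A t} : Set (Fin n → V)).ncard ≤ 𝒢.card := by
  choose! Z hZ hgen using hA
  rw [← Set.ncard_coe_finset]
  exact Set.ncard_le_ncard_of_injOn Z hZ
    (fun t ht u hu htu => (hgen t ht).unique (htu ▸ hgen u hu)) 𝒢.finite_toSet

variable [MeasurableSpace 𝔼] {q ε r : ℝ} {𝒢 : Finset (List 𝔼)}

theorem Transformer.ncard_ballAccessible_le (h𝒢 : IsOpenPromptNet q ε r 𝒢) :
    {t : Fin n → V | τ.BallAccessible g q ε r t}.ncard ≤ 𝒢.card :=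
  ncard_le_of_generates fun _ ⟨X, hX, hball⟩ =>
    let ⟨Z, hZ, hXZ⟩ := h𝒢.exists_promptDist_lt X hX
    ⟨Z, hZ, (hball Z (h𝒢.isPrompt Z hZ) hXZ).2.2⟩

theorem Transformer.HasWassersteinPrecision.ncard_accessible_le
    (hτ : τ.HasWassersteinPrecision g q ε r) (h𝒢 : IsPromptNet q ε r 𝒢) :
    {t : Fin n → V | τ.Accessible g r t}.ncard ≤ 𝒢.card :=
  let ⟨_, _, hmin, hsame⟩ := hτ
  (ncard_le_of_generates fun t ⟨_, X, _, hX, hgen⟩ =>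
    let ⟨Z, hZ, _, hXZ⟩ := hsame X hX
    ⟨Z, hZ, (hXZ n t).1 hgen⟩).trans (hmin 𝒢 h𝒢)

end Generates

variable [Fintype V]

theorem exists_not_of_ncard_le (hV : 1 < Fintype.card V) {A : (Fin n → V) → Prop} {B D : ℝ}
    (hB : 0 < B) (hA : (({t | A t} : Set (Fin n → V)).ncard : ℝ) ≤ B ^ D)
    (hn : D * Real.log B / Real.log (Fintype.card V) < n) : ∃ t, ¬ A t := by
  have hV' : (1 : ℝ) < Fintype.card V := by exact_mod_cast hV
  rw [div_lt_iff₀ (Real.log_pos hV'), ← Real.log_rpow hB, ← Real.log_pow] at hn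
  have hlt : B ^ D < (Fintype.card V : ℝ) ^ n :=
    (Real.log_lt_log_iff (by positivity) (by positivity)).1 hn
  contrapose! hlt with hall
  rw [Set.eq_univ_of_forall (s := {t | A t}) hall, Set.ncard_univ, Nat.card_eq_fintype_card,
    Fintype.card_fun, Fintype.card_fin] at hA
  exact_mod_cast hA

theorem proportion_le_of_ncard_le {A : (Fin n → V) → Prop} {C : ℝ}
    (hA : (({t | A t} : Set (Fin n → V)).ncard : ℝ) ≤ C) :
    proportion A ≤ C / (Fintype.card V : ℝ) ^ n :=
  div_le_div_of_nonneg_right hA (by positivity)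

theorem isBigO_proportion {A : ∀ n, (Fin n → V) → Prop} {C : ℝ}
    (hA : ∀ n, (({t | A n t} : Set (Fin n → V)).ncard : ℝ) ≤ C) :
    (fun n => proportion (A n)) =O[atTop] fun n => 1 / (Fintype.card V : ℝ) ^ n := by
  refine .of_bound C (.of_forall fun n => ?_)
  rw [Real.norm_of_nonneg (by rw [proportion]; positivity), Real.norm_of_nonneg (by positivity),
    mul_one_div]
  exact proportion_le_of_ncard_le (hA n)

end TokenSequences

theorem mainTheorem4 {V 𝔼 : Type*} [Fintype V]
    [NormedAddCommGroup 𝔼] [NormedSpace ℝ 𝔼] [FiniteDimensional ℝ 𝔼]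
    [MeasurableSpace 𝔼] [BorelSpace 𝔼]
    (d : ℕ) (hd : Module.finrank ℝ 𝔼 = d) (hV : 2 ≤ Fintype.card V)
    (τ : Transformer V 𝔼) (g : GreedyRule V)
    (q ε r : ℝ) (hq : 1 ≤ q) (hε : 0 < ε) (hr : 0 < r) :
    ((∀ n : ℕ, (1 + 4 * r / ε) ^ d * Real.log (Real.exp 1 + Real.exp 1 * (2 * r) ^ q / ε ^ q)
            / Real.log (Fintype.card V) < n →
          ∃ t : Fin n → V, ¬ τ.BallAccessible g q ε r t) ∧
      (∀ n : ℕ, proportion (fun t : Fin n → V => τ.BallAccessible g q ε r t) ≤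
          (Real.exp 1 + Real.exp 1 * (2 * r) ^ q / ε ^ q) ^ ((1 + 4 * r / ε) ^ d)
            / (Fintype.card V : ℝ) ^ n) ∧
      (fun n : ℕ => proportion (fun t : Fin n → V => τ.BallAccessible g q ε r t))
        =O[Filter.atTop] (fun n : ℕ => 1 / (Fintype.card V : ℝ) ^ n)) ∧
    (τ.HasWassersteinPrecision g q ε r →
      (∀ n : ℕ, (1 + 4 * r / ε) ^ d * Real.log (Real.exp 1 + Real.exp 1 * (2 * r) ^ q / ε ^ q)
            / Real.log (Fintype.card V) < n →
          ∃ t : Fin n → V, ¬ τ.Accessible g r t) ∧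
      (∀ n : ℕ, proportion (fun t : Fin n → V => τ.Accessible g r t) ≤
          (Real.exp 1 + Real.exp 1 * (2 * r) ^ q / ε ^ q) ^ ((1 + 4 * r / ε) ^ d)
            / (Fintype.card V : ℝ) ^ n) ∧
      (fun n : ℕ => proportion (fun t : Fin n → V => τ.Accessible g r t))
        =O[Filter.atTop] (fun n : ℕ => 1 / (Fintype.card V : ℝ) ^ n)) := by
  subst hd
  obtain ⟨𝒢, h𝒢, hcard⟩ := exists_isOpenPromptNet_card_le (𝔼 := 𝔼) hq hε hr
  have hB : 0 < Real.exp 1 + Real.exp 1 * (2 * r) ^ q / ε ^ q := by positivity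
  have hball (n : ℕ) := (Nat.cast_le.2 <|
    Transformer.ncard_ballAccessible_le (τ := τ) (g := g) (n := n) h𝒢).trans hcard
  refine ⟨⟨fun n => exists_not_of_ncard_le hV hB (hball n),
    fun n => proportion_le_of_ncard_le (hball n), isBigO_proportion hball⟩, fun hτ => ?_⟩
  have hacc (n : ℕ) := (Nat.cast_le.2 <|
    hτ.ncard_accessible_le (n := n) h𝒢.isPromptNet).trans hcard
  exact ⟨fun n => exists_not_of_ncard_le hV hB (hacc n),
    fun n => proportion_le_of_ncard_le (hacc n), isBigO_proportion hacc⟩
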